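/- Theorem (unitary power dilations). Let $\varkappa$ be a positive integer, $\mathbb Z_+=\{0,1,2,\dots\}$, $\mathbb Z_-=-\mathbb Z_+$, $\mathbb T=\{z\in\mathbb C:|z|=1\}$, and $\lambda^\alpha=\lambda_1^{\alpha_1}\cdots\lambda_\varkappa^{\alpha_\varkappa}$ for $\lambda\in\mathbb T^\varkappa$, $\alpha\in\mathbb Z^\varkappa$. An analytic trigonometric polynomial is a function $\mathbb T^\varkappa\to\mathbb C$ of the form $z\mapsto\sum_{\alpha\in\mathbb Z_+^\varkappa}a_\alpha z^\alpha$ with only finitely many nonzero coefficients $a_\alpha \in \mathbb C$; the set of these functions is denoted by $\mathcal P_+(\mathbb T^\varkappa)$. A nonempty set $Y\subset\mathbb T^\varkappa$ is called determining for $\mathcal P_+(\mathbb T^\varkappa)$ if every $p\in\mathcal P_+(\mathbb T^\varkappa)$ vanishing on $Y$ vanishes on the whole of $\mathbb T^\varkappa$. Let $\mathbf A=(A_1,\dots,A_\varkappa)$ be a $\varkappa$-tuple of bounded linear operators on a complex Hilbert space $\mathcal H$, with inner product $\langle\cdot,\cdot\rangle$ linear in the first variable, and define $$\mathbf A^{[\alpha]}=\begin{cases}A_1^{\alpha_1}\cdots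 A_\varkappa^{\alpha_\varkappa},&\alpha\in\mathbb Z_+^\varkappa,\\ A_1^{*|\alpha_1|}\cdots A_\varkappa^{*|\alpha_\varkappa|},&\alpha\in\mathbb Z_-^\varkappa.\end{cases}$$ For $\alpha\in\mathbb Z_+^\varkappa$ write $\mathbf A^\alpha=\mathbf A^{[\alpha]}$. The tuple $\mathbf A$ is said to have a unitary power dilation if there are a complex Hilbert space $\mathcal K\supset\mathcal H$ (isometric embedding) and a $\varkappa$-tuple $\mathbf U=(U_1,\dots,U_\varkappa)$ of commuting unitary operators on $\mathcal K$ such that $\mathbf A^\alpha=P\mathbf U^\alpha|_{\mathcal H}$ for all $\alpha\in\mathbb Z_+^\varkappa$, where $P$ is the orthogonal projection of $\mathcal K$ onto $\mathcal H$. Let $Y$ be a determining set for $\mathcal P_+(\mathbb T^\varkappa)$. Then the following conditions are equivalent: (i) $\mathbf A$ has a unitary power dilation and the operators $A_1,\dots,A_\varkappa$ commute; (ii) for every $m$ and every finite system (all but finitely many terms zero) $\{a^{i,j}_\alpha: i,j=1,\dots,m,\ \alpha\in\mathbb Z_+^\varkappa\cup\mathbb Z_-^\varkappa\}\subset\mathbb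 C$, if $$\sum_{i,j=1}^m\ \sum_{\alpha\in\mathbb Z_+^\varkappa\cup\mathbb Z_-^\varkappa}a^{i,j}_\alpha\lambda^\alpha z_i\bar z_j\ge 0\quad\text{for all }\lambda\in\mathbb T^\varkappa,\ z_1,\dots,z_m\in\mathbb C,$$ then $$\sum_{i,j=1}^m\ \sum_{\alpha\in\mathbb Z_+^\varkappa\cup\mathbb Z_-^\varkappa}a^{i,j}_\alpha\langle\mathbf A^{[\alpha]}f_i,f_j\rangle\ge 0\quad\text{for all }f_1,\dots,f_m\in\mathcal H;\tag{$*$}$$ (iii) for every $m$ and every finite system $\{a^{i,j}_\alpha: i,j=1,\dots,m,\ \alpha\in\mathbb Z_+^\varkappa\cup\mathbb Z_-^\varkappa\}\subset\mathbb C$, if there is a finite matrix $[q_{i,l}]_{i=1}^m{}_{l=1}^k$ with entries in $\mathcal P_+(\mathbb T^\varkappa)$ such that $$\sum_{\alpha\in\mathbb Z_+^\varkappa\cup\mathbb Z_-^\varkappa}a^{i,j}_\alpha\lambda^\alpha=\sum_{l=1}^k q_{i,l}(\lambda)\overline{q_{j,l}(\lambda)}\quad\text{for all }\lambda\in Y,\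 i,j=1,\dots,m,$$ then $(*)$ holds. (Here $w\ge0$ for a complex number $w$ means that $w$ is real and nonnegative.) -/

import Mathlib

open scoped ComplexOrder ComplexConjugate

namespace UnitaryPowerDilation

universe u

/-- The torus `𝕋^κ`. -/
abbrev Torus (κ : ℕ) : Type := Fin κ → Circle

/-- The set `ℤ₊^κ` of multi-indices with nonnegative entries. -/
def nonnegIndices (κ : ℕ) : Set (Fin κ → ℤ) := {α | ∀ i, 0 ≤ α i}

/-- The set `ℤ₋^κ` of multi-indices with nonpositive entries. -/
def nonposIndices (κ : ℕ) : Set (Fin κ → ℤ) := {α | ∀ i, α i ≤ 0}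

/-- The set `ℤ₊^κ ∪ ℤ₋^κ`. -/
def signedIndices (κ : ℕ) : Set (Fin κ → ℤ) := nonnegIndices κ ∪ nonposIndices κ

/-- The monomial `z^α = z₁^{α₁} ⋯ z_κ^{α_κ}` on the torus. -/
noncomputable def monomial {κ : ℕ} (α : Fin κ → ℤ) (z : Torus κ) : ℂ :=
  ∏ i, (z i : ℂ) ^ α i

/-- The value `∑_{α ∈ T} a_α z^α`, for a finite system `(a_α)_{α ∈ T}` of complex numbers. -/
noncomputable def trigSum {κ : ℕ} {T : Set (Fin κ → ℤ)} (a : T →₀ ℂ) (z : Torus κ) : ℂ :=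
  a.sum fun α c => c * monomial (α : Fin κ → ℤ) z

/-- The trigonometric polynomials, as functions on the torus, with coefficients supported in `T`. -/
def trigPolys {κ : ℕ} (T : Set (Fin κ → ℤ)) : Set (Torus κ → ℂ) :=
  {p | ∃ a : T →₀ ℂ, ∀ z, p z = trigSum a z}

/-- The analytic trigonometric polynomials. -/
def analyticTrigPolys (κ : ℕ) : Set (Torus κ → ℂ) := trigPolys (nonnegIndices κ)

/-- A nonempty set `Y` is determining for a class `P` of functions on the torus if every member
of `P` that vanishes on `Y` vanishes everywhere. -/
def IsDetermining {κ : ℕ} (P : Set (Torus κ → ℂ)) (Y : Set (Torus κ)) : Prop :=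
  Y.Nonempty ∧ ∀ p ∈ P, (∀ z ∈ Y, p z = 0) → ∀ z, p z = 0

/-- The product `A₁^{α₁} ⋯ A_κ^{α_κ}`, in this order. -/
def multiPow {M : Type*} [Monoid M] {κ : ℕ} (A : Fin κ → M) (α : Fin κ → ℕ) : M :=
  (List.ofFn fun i => A i ^ α i).prod

section Operators

variable {H : Type u} [NormedAddCommGroup H] [InnerProductSpace ℂ H] [CompleteSpace H]

open Classical in
/-- `A^{[α]}`: the product `A₁^{α₁} ⋯ A_κ^{α_κ}` for `α ∈ ℤ₊^κ`, and the product
`A₁^{*|α₁|} ⋯ A_κ^{*|α_κ|}` for `α ∈ ℤ₋^κ`, both in this order. -/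
noncomputable def signedPow {κ : ℕ} (A : Fin κ → H →L[ℂ] H) (α : signedIndices κ) : H →L[ℂ] H :=
  if (α : Fin κ → ℤ) ∈ nonnegIndices κ then
    multiPow A fun i => ((α : Fin κ → ℤ) i).natAbs
  else
    multiPow (fun i => ContinuousLinearMap.adjoint (A i)) fun i => ((α : Fin κ → ℤ) i).natAbs

/-- The range of a linear isometric embedding of a complete space is complete, so the orthogonal
projection onto it exists. -/
instance hasOrthogonalProjection_range {K : Type*} [NormedAddCommGroup K] [InnerProductSpace ℂ K]
    (V : H →ₗᵢ[ℂ] K) : V.toLinearMap.range.HasOrthogonalProjection := by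
  have : CompleteSpace V.toLinearMap.range := by
    apply IsComplete.completeSpace_coe
    have h : IsComplete (Set.range V) := V.isometry.isUniformInducing.isComplete_range
    rw [LinearMap.coe_range]
    exact h
  infer_instance

/-- The tuple `A` has a unitary power dilation: there are a complex Hilbert space `K`, an isometric
embedding `V` of `H` into `K` and commuting unitary operators `U₁, …, U_κ` on `K` such that,
with `H` identified with `V(H)` and `P` the orthogonal projection of `K` onto `V(H)`,
`A^α = P U^α|_H` for every `α ∈ ℤ₊^κ`. -/
def HasUnitaryPowerDilation {κ : ℕ} (A : Fin κ → H →L[ℂ] H) : Prop :=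
  ∃ (K : Type u) (_ : NormedAddCommGroup K) (_ : InnerProductSpace ℂ K) (_ : CompleteSpace K)
    (V : H →ₗᵢ[ℂ] K) (U : Fin κ → K →L[ℂ] K),
    (∀ i, U i ∈ unitary (K →L[ℂ] K)) ∧ (∀ i j, Commute (U i) (U j)) ∧
      ∀ (α : Fin κ → ℕ) (f : H),
        V (multiPow A α f) = V.toLinearMap.range.starProjection (multiPow U α (V f))

/-- The sum `∑_{i,j} ∑_α a_α^{i,j} ⟨A^{[α]} f_i, f_j⟩`, where the inner product is linear in the
first place; Mathlib's `inner ℂ x y` is linear in `y`. -/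
noncomputable def operatorSum {κ m : ℕ} (A : Fin κ → H →L[ℂ] H)
    (a : Fin m → Fin m → signedIndices κ →₀ ℂ) (f : Fin m → H) : ℂ :=
  ∑ i, ∑ j, (a i j).sum fun α c => c * inner ℂ (f j) (signedPow A α (f i))

end Operators

end UnitaryPowerDilation

/-! From a dilation to positivity: if `U` dilates a commuting tuple, the vectors `U^n f_i` with `n ≥
0` have inner products `⟨A^{[n-l]} f_i, f_j⟩` whenever `n - l` is a signed index. The block Toeplitz
matrix of a nonnegative matrix polynomial is positive semidefinite. Testing it on these vectors over
the box `[0, N)^κ` and dividing by `N^κ` gives the operator sum with Fejér weights, which tend to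
`1` (`nonneg_of_translationInvariant`).

From (ii) to (iii): a monomial has modulus one and can turn any trigonometric polynomial into an
analytic one. So an identity on `Y` spreads to the whole torus, where a sum of squares is
nonnegative.

From (iii) to a dilation: on the symbols `λ^α ⊗ f ⊗ g` with `α` signed, the functional `⟨A^{[α]} f,
g⟩` is nonnegative on sums of hermitian squares. Every symbol is dominated by symbols of index `0`,
so the M. Riesz theorem extends the functional positively to all `α ∈ ℤ^κ`
(`IsSquarePositive.exists_functional`). A GNS construction on `H`-valued trigonometric polynomials
then gives a Hilbert space on which multiplication by monomials is a unitary representation of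
`ℤ^κ`; `H` sits inside as the constants (`IsSquarePositive.exists_representation`). Commutativity
comes from the same positivity: it forces `A^{[-α]} = (A^{[α]})*`, and taking the adjoint reverses
the fixed order of the factors. -/

namespace UnitaryPowerDilation

universe u

/-! ### Trigonometric polynomials and determining sets -/

section TrigonometricPolynomials

variable {κ : ℕ}

theorem monomial_zero (z : Torus κ) : monomial 0 z = 1 := by
  simp [monomial]

theorem monomial_add (α β : Fin κ → ℤ) (z : Torus κ) :
    monomial (α + β) z = monomial α z * monomial β z := by
  simp [monomial, ← Finset.prod_mul_distrib, zpow_add₀]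

theorem conj_monomial (α : Fin κ → ℤ) (z : Torus κ) :
    conj (monomial α z) = monomial (-α) z := by
  simp only [monomial, map_prod, map_zpow₀, Pi.neg_apply, zpow_neg, ← inv_zpow]
  refine Finset.prod_congr rfl fun i _ => ?_
  rw [← Circle.coe_inv_eq_conj, Circle.coe_inv]

theorem monomial_mul_conj (α : Fin κ → ℤ) (z : Torus κ) :
    monomial α z * conj (monomial α z) = 1 := by
  rw [conj_monomial, ← monomial_add, add_neg_cancel, monomial_zero]

theorem monomial_ne_zero (α : Fin κ → ℤ) (z : Torus κ) : monomial α z ≠ 0 :=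
  left_ne_zero_of_mul_eq_one (monomial_mul_conj α z)

theorem monomial_sub (α β : Fin κ → ℤ) (z : Torus κ) :
    monomial (α - β) z = monomial α z * conj (monomial β z) := by
  rw [sub_eq_add_neg, monomial_add, conj_monomial]

theorem trigPolys_eq_span (T : Set (Fin κ → ℤ)) :
    trigPolys T = (Submodule.span ℂ (monomial '' T) : Set (Torus κ → ℂ)) := by
  ext p
  rw [SetLike.mem_coe, Set.image_eq_range, Finsupp.mem_span_range_iff_exists_finsupp]
  refine exists_congr fun a => ?_
  rw [funext_iff]
  refine forall_congr' fun z => ?_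
  rw [eq_comm]
  simp [trigSum, Finsupp.sum, Finset.sum_apply]

theorem mem_trigPolys_of_span {T : Set (Fin κ → ℤ)} {p : Torus κ → ℂ} :
    p ∈ trigPolys T ↔ p ∈ Submodule.span ℂ (monomial '' T) := by
  rw [trigPolys_eq_span]; rfl

theorem trigSum_mem {T : Set (Fin κ → ℤ)} (a : T →₀ ℂ) :
    (fun z => trigSum a z) ∈ Submodule.span ℂ (monomial '' T) :=
  mem_trigPolys_of_span.1 ⟨a, fun _ => rfl⟩

theorem mul_mem_span_monomial {p q : Torus κ → ℂ}
    (hp : p ∈ Submodule.span ℂ (Set.range monomial))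
    (hq : q ∈ Submodule.span ℂ (Set.range monomial)) :
    p * q ∈ Submodule.span ℂ (Set.range monomial) := by
  have h := Submodule.mul_mem_mul hp hq
  rw [Submodule.span_mul_span] at h
  refine Submodule.span_mono ?_ h
  rintro _ ⟨_, ⟨α, rfl⟩, _, ⟨β, rfl⟩, rfl⟩
  exact ⟨α + β, funext fun z => monomial_add α β z⟩

theorem conj_mem_span_monomial {p : Torus κ → ℂ}
    (hp : p ∈ Submodule.span ℂ (Set.range monomial)) :
    (fun z => conj (p z)) ∈ Submodule.span ℂ (Set.range monomial) := by
  induction hp using Submodule.span_induction with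
  | mem x h =>
    obtain ⟨α, rfl⟩ := h
    exact Submodule.subset_span ⟨-α, funext fun z => (conj_monomial α z).symm⟩
  | zero => simp only [Pi.zero_apply, map_zero]; exact Submodule.zero_mem _
  | add x y _ _ hx hy =>
    simp only [Pi.add_apply, map_add]
    exact Submodule.add_mem _ hx hy
  | smul c x _ hx =>
    simp only [Pi.smul_apply, smul_eq_mul, map_mul]
    exact Submodule.smul_mem _ (conj c) hx

/-- Every trigonometric polynomial becomes analytic after multiplication with a monomial. -/
theorem exists_monomial_mul_mem {p : Torus κ → ℂ}
    (hp : p ∈ Submodule.span ℂ (Set.range monomial)) :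
    ∃ N ∈ nonnegIndices κ, monomial N * p ∈ Submodule.span ℂ (monomial '' nonnegIndices κ) := by
  have shift : ∀ {N : Fin κ → ℤ} {q : Torus κ → ℂ}, N ∈ nonnegIndices κ →
      q ∈ Submodule.span ℂ (monomial '' nonnegIndices κ) →
      monomial N * q ∈ Submodule.span ℂ (monomial '' nonnegIndices κ) := by
    intro N q hN hq
    have h := Submodule.mul_mem_mul
      (Submodule.subset_span (R := ℂ) (Set.mem_image_of_mem monomial hN)) hq
    rw [Submodule.span_mul_span] at h
    refine Submodule.span_mono ?_ h
    rintro _ ⟨_, ⟨α, hα, rfl⟩, _, ⟨β, hβ, rfl⟩, rfl⟩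
    exact ⟨α + β, fun i => add_nonneg (hα i) (hβ i), funext fun z => monomial_add α β z⟩
  induction hp using Submodule.span_induction with
  | mem x h =>
    obtain ⟨α, rfl⟩ := h
    -- The shift by `|α|` works because `|α i| + α i ≥ 0`.
    refine ⟨fun i => |α i|, fun i => abs_nonneg _, Submodule.subset_span
      ⟨(fun i => |α i|) + α, fun i => ?_, funext fun z => monomial_add _ _ z⟩⟩
    have := neg_abs_le (α i)
    simp only [Pi.add_apply]
    linarith
  | zero => exact ⟨0, fun _ => le_rfl, by simp⟩
  | add x y _ _ hx hy =>
    obtain ⟨N, hN, hx⟩ := hx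
    obtain ⟨M, hM, hy⟩ := hy
    refine ⟨N + M, fun i => add_nonneg (hN i) (hM i), ?_⟩
    have e : monomial (N + M) * (x + y)
        = monomial M * (monomial N * x) + monomial N * (monomial M * y) := by
      funext z
      simp only [Pi.mul_apply, Pi.add_apply, monomial_add]
      ring
    rw [e]
    exact Submodule.add_mem _ (shift hM hx) (shift hN hy)
  | smul c x _ hx =>
    obtain ⟨N, hN, hx⟩ := hx
    exact ⟨N, hN, by rw [mul_smul_comm]; exact Submodule.smul_mem _ c hx⟩

/-- A set which is determining for the analytic trigonometric polynomials is determining for all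
trigonometric polynomials. -/
theorem IsDetermining.eq_zero {Y : Set (Torus κ)} (hY : IsDetermining (analyticTrigPolys κ) Y)
    {p : Torus κ → ℂ} (hp : p ∈ Submodule.span ℂ (Set.range monomial))
    (h0 : ∀ z ∈ Y, p z = 0) (z : Torus κ) : p z = 0 := by
  obtain ⟨N, -, hN⟩ := exists_monomial_mul_mem hp
  have := hY.2 _ (mem_trigPolys_of_span.2 hN) (fun w hw => by simp [h0 w hw]) z
  exact (mul_eq_zero.1 this).resolve_left (monomial_ne_zero N z)

/-- An identity between a trigonometric polynomial and a sum of products of analytic ones and their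
conjugates holds everywhere as soon as it holds on a determining set. -/
theorem IsDetermining.trigSum_eq {Y : Set (Torus κ)}
    (hY : IsDetermining (analyticTrigPolys κ) Y) {T : Set (Fin κ → ℤ)} (a : T →₀ ℂ) {k : ℕ}
    {q r : Fin k → Torus κ → ℂ} (hq : ∀ l, q l ∈ analyticTrigPolys κ)
    (hr : ∀ l, r l ∈ analyticTrigPolys κ)
    (h : ∀ t ∈ Y, trigSum a t = ∑ l, q l t * conj (r l t)) (t : Torus κ) :
    trigSum a t = ∑ l, q l t * conj (r l t) := by
  have mono : ∀ {S : Set (Fin κ → ℤ)} {p : Torus κ → ℂ},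
      p ∈ Submodule.span ℂ (monomial '' S) → p ∈ Submodule.span ℂ (Set.range monomial) :=
    fun h => Submodule.span_mono (Set.image_subset_range _ _) h
  refine sub_eq_zero.1 (hY.eq_zero (p := fun t => trigSum a t - ∑ l, q l t * conj (r l t))
    ?_ (fun z hz => sub_eq_zero.2 (h z hz)) t)
  refine Submodule.sub_mem _ (mono (trigSum_mem a)) ?_
  have e : (fun t => ∑ l, q l t * conj (r l t)) = ∑ l, q l * fun t => conj (r l t) := by
    funext t
    simp [Finset.sum_apply]
  rw [e]
  exact Submodule.sum_mem _ fun l _ => mul_mem_span_monomial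
    (mono (mem_trigPolys_of_span.1 (hq l)))
    (conj_mem_span_monomial (mono (mem_trigPolys_of_span.1 (hr l))))

end TrigonometricPolynomials

/-! ### Ordered products of powers -/

section MultiPow

variable {M : Type*} [Monoid M] {κ : ℕ}

theorem commute_multiPow {A : Fin κ → M} {x : M} (h : ∀ i, Commute x (A i)) (α : Fin κ → ℕ) :
    Commute x (multiPow A α) := by
  refine Commute.list_prod_right _ _ fun y hy => ?_
  obtain ⟨i, rfl⟩ := List.mem_ofFn.1 hy
  exact (h i).pow_right _

theorem multiPow_succ_eq {κ : ℕ} (A : Fin (κ + 1) → M) (α : Fin (κ + 1) → ℕ) :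
    multiPow A α = A 0 ^ α 0 * multiPow (fun i : Fin κ => A i.succ) fun i => α i.succ := by
  simp [multiPow, List.ofFn_succ]

theorem multiPow_add {κ : ℕ} {A : Fin κ → M} (h : ∀ i j, Commute (A i) (A j)) (α β : Fin κ → ℕ) :
    multiPow A (α + β) = multiPow A α * multiPow A β := by
  induction κ with
  | zero => simp [multiPow]
  | succ κ ih =>
    simp only [multiPow_succ_eq]
    rw [Pi.add_apply, pow_add]
    have := ih (A := fun i => A i.succ) (fun i j => h _ _) (fun i => α i.succ) (fun i => β i.succ)
    have e : (fun i : Fin κ => (α + β) i.succ) = (fun i => α i.succ) + fun i => β i.succ := rfl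
    rw [e, this]
    have c : Commute (A 0 ^ β 0) (multiPow (fun i : Fin κ => A i.succ) fun i => α i.succ) :=
      commute_multiPow (fun i => (h 0 i.succ).pow_left _) _
    simp only [mul_assoc]
    rw [← mul_assoc (A 0 ^ β 0), c.eq, mul_assoc]

theorem multiPow_zero (A : Fin κ → M) : multiPow A 0 = 1 := by
  simp [multiPow, List.ofFn_const]

theorem multiPow_single (A : Fin κ → M) (i : Fin κ) : multiPow A (Pi.single i 1) = A i := by
  induction κ with
  | zero => exact i.elim0
  | succ κ ih =>
    rw [multiPow_succ_eq]
    refine Fin.cases ?_ (fun i => ?_) i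
    · have : (fun i : Fin κ => (Pi.single (0 : Fin (κ + 1)) 1 : Fin (κ + 1) → ℕ) i.succ) = 0 := by
        funext j; simp
      rw [this, multiPow_zero]; simp
    · have : (fun j : Fin κ => (Pi.single i.succ 1 : Fin (κ + 1) → ℕ) j.succ)
          = Pi.single i 1 := by
        funext j; simp [Pi.single_apply]
      rw [this, ih]; simp

theorem map_multiPow {N F : Type*} [Monoid N] [FunLike F M N] [MonoidHomClass F M N] (φ : F)
    (A : Fin κ → M) (α : Fin κ → ℕ) : φ (multiPow A α) = multiPow (fun i => φ (A i)) α := by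
  simp [multiPow, map_list_prod, List.map_ofFn, Function.comp_def]

theorem multiPow_mem {S : Submonoid M} {A : Fin κ → M} (h : ∀ i, A i ∈ S) (α : Fin κ → ℕ) :
    multiPow A α ∈ S := by
  refine S.list_prod_mem fun y hy => ?_
  obtain ⟨i, rfl⟩ := List.mem_ofFn.1 hy
  exact S.pow_mem (h i) _

/-- The involution reverses the order of the factors, and commutativity restores it. Without
commutativity this fails, which is what later allows commutativity to be recovered. -/
theorem star_multiPow [StarMul M] {A : Fin κ → M} (h : ∀ i j, Commute (A i) (A j))
    (α : Fin κ → ℕ) : star (multiPow A α) = multiPow (fun i => star (A i)) α := by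
  induction κ with
  | zero => simp [multiPow]
  | succ κ ih =>
    rw [multiPow_succ_eq, multiPow_succ_eq, star_mul, star_pow,
      ih (A := fun i => A i.succ) (fun i j => h _ _)]
    refine (Commute.eq ?_).symm
    exact commute_multiPow (fun i => (((h i.succ 0).star_star).symm).pow_left _) _

theorem multiPow_ofAdd_single (α : Fin κ → ℕ) :
    multiPow (fun i => Multiplicative.ofAdd (Pi.single i 1 : Fin κ → ℤ)) α
      = Multiplicative.ofAdd fun i => (α i : ℤ) := by
  rw [multiPow, List.prod_ofFn]
  simp only [← ofAdd_nsmul, ← ofAdd_sum]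
  congr 1
  funext j
  simp [Finset.sum_apply, Pi.single_apply]

end MultiPow

/-- A finite family of vectors can be expanded in a finite family which acts on it as an
orthonormal basis. -/
theorem exists_finite_expansion {E ι : Type*} [NormedAddCommGroup E] [InnerProductSpace ℂ E]
    [Finite ι] (v : ι → E) :
    ∃ (m : ℕ) (b : Fin m → E), ∀ s, ∑ k, inner ℂ (b k) (v s) • b k = v s := by
  let S : Submodule ℂ E := Submodule.span ℂ (Set.range v)
  have : FiniteDimensional ℂ S := FiniteDimensional.span_of_finite ℂ (Set.finite_range v)
  refine ⟨_, fun k => (stdOrthonormalBasis ℂ S k : E), fun s => ?_⟩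
  have := congrArg Subtype.val ((stdOrthonormalBasis ℂ S).sum_repr'
    ⟨v s, Submodule.subset_span ⟨s, rfl⟩⟩)
  simpa using this

theorem nonneg_of_natCast_pow_mul_nonneg {N k : ℕ} (hN : 0 < N) {w : ℂ}
    (h : 0 ≤ (N : ℂ) ^ k * w) : 0 ≤ w := by
  have h0 : (N : ℂ) ^ k ≠ 0 := pow_ne_zero _ (by exact_mod_cast hN.ne')
  have h1 : (0 : ℂ) ≤ (((N : ℝ) ^ k)⁻¹ : ℝ) := by
    rw [Complex.zero_le_real]; positivity
  have h2 := mul_nonneg h1 h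
  push_cast at h2
  rwa [inv_mul_cancel_left₀ h0] at h2

/-! ### Toeplitz positivity and Fejér averaging -/

section Averaging

variable {κ : ℕ}

/-- Orthogonality of monomials with respect to the average over the `M`-th roots of unity. -/
theorem exists_average (κ M : ℕ) (hM : 0 < M) :
    ∃ t : (Fin κ → Fin M) → Torus κ, ∀ δ : Fin κ → ℤ, (∀ k, |δ k| < M) →
      ∑ x, monomial δ (t x) = if δ = 0 then (M : ℂ) ^ κ else 0 := by
  let ω : Circle := Circle.exp (2 * Real.pi / M)
  have hω : IsPrimitiveRoot (ω : ℂ) M := by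
    have := Complex.isPrimitiveRoot_exp M hM.ne'
    convert! this using 1
    rw [Circle.coe_exp]
    congr 1
    push_cast
    ring
  refine ⟨fun x k => ω ^ (x k : ℕ), fun δ hδ => ?_⟩
  have e : ∀ x : Fin κ → Fin M, monomial δ (fun k => ω ^ (x k : ℕ))
      = ∏ k, (((ω : ℂ) ^ δ k) ^ (x k : ℕ)) := by
    intro x
    refine Finset.prod_congr rfl fun k _ => ?_
    rw [Circle.coe_pow, ← zpow_natCast, ← zpow_natCast, ← zpow_mul, ← zpow_mul, mul_comm]
  have key := Finset.prod_univ_sum (fun _ : Fin κ => (Finset.univ : Finset (Fin M)))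
    (fun k y => ((ω : ℂ) ^ δ k) ^ (y : ℕ))
  rw [Fintype.piFinset_univ] at key
  simp only [e, ← key]
  split_ifs with h
  · subst h; simp
  -- The sum factors over the coordinates. A coordinate with `0 < |δ k| < M` contributes a full
  -- geometric sum of a nontrivial `M`-th root of unity, which is zero.
  · obtain ⟨k, hk⟩ := Function.ne_iff.1 h
    refine Finset.prod_eq_zero (Finset.mem_univ k) ?_
    have h1 : (ω : ℂ) ^ δ k ≠ 1 := by
      rw [Ne, hω.zpow_eq_one_iff_dvd]
      intro hd
      exact hk (Int.eq_zero_of_abs_lt_dvd hd (hδ k))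
    have h2 : ((ω : ℂ) ^ δ k) ^ M = 1 := by
      rw [← zpow_natCast, zpow_comm, zpow_natCast, hω.pow_eq_one, one_zpow]
    rw [Fin.sum_univ_eq_sum_range (fun y => ((ω : ℂ) ^ δ k) ^ y)]
    have h3 := mul_neg_geom_sum ((ω : ℂ) ^ δ k) M
    rw [h2, sub_self] at h3
    exact (mul_eq_zero.1 h3).resolve_left (sub_ne_zero.2 h1.symm)

variable {m : ℕ} {T : Set (Fin κ → ℤ)}

/-- The block Toeplitz matrix of a nonnegative matrix trigonometric polynomial is positive
semidefinite. -/
theorem toeplitz_nonneg (a : Fin m → Fin m → T →₀ ℂ)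
    (ha : ∀ (t : Torus κ) (z : Fin m → ℂ), 0 ≤ ∑ i, ∑ j, trigSum (a i j) t * z i * conj (z j))
    (s : Finset (Fin κ → ℤ)) (z : Fin m → (Fin κ → ℤ) → ℂ) :
    0 ≤ ∑ i, ∑ j, (a i j).sum fun α c => c * ∑ n ∈ s, ∑ l ∈ s,
      if (α : Fin κ → ℤ) = n - l then z i n * conj (z j l) else 0 := by
  classical
  -- `M` exceeds every frequency that occurs below, so the discrete average detects `α = n - l`
  -- exactly, with no aliasing.
  obtain ⟨M, hM0, hM⟩ : ∃ M : ℕ, 0 < M ∧ ∀ i j, ∀ α ∈ (a i j).support, ∀ n ∈ s, ∀ l ∈ s, ∀ k,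
      |((α : Fin κ → ℤ) - (n - l)) k| < M := by
    let F : Finset ℤ := Finset.univ.biUnion fun i => Finset.univ.biUnion fun j =>
      (a i j).support.biUnion fun α => s.biUnion fun n => s.biUnion fun l =>
        Finset.univ.image fun k => |((α : Fin κ → ℤ) - (n - l)) k|
    obtain ⟨B, hB⟩ := F.bddAbove
    refine ⟨(B + 1).toNat + 1, Nat.succ_pos _, fun i j α hα n hn l hl k => ?_⟩
    have : |((α : Fin κ → ℤ) - (n - l)) k| ≤ B := hB (by
      simp only [F, Finset.coe_biUnion, Set.mem_iUnion, Finset.coe_image]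
      exact ⟨i, by simp, j, by simp, α, hα, n, hn, l, hl, k, by simp, rfl⟩)
    omega
  obtain ⟨t, ht⟩ := exists_average κ M hM0
  -- The hypothesis is tested at each `t x` on the vector with entries `∑ n, z i n * conj (t^n)`;
  -- averaging keeps the terms with `α = n - l`.
  have main : ∑ x, ∑ i, ∑ j, trigSum (a i j) (t x) * (∑ n ∈ s, z i n * conj (monomial n (t x)))
        * conj (∑ l ∈ s, z j l * conj (monomial l (t x)))
      = (M : ℂ) ^ κ * ∑ i, ∑ j, (a i j).sum fun α c => c * ∑ n ∈ s, ∑ l ∈ s,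
        if (α : Fin κ → ℤ) = n - l then z i n * conj (z j l) else 0 := by
    rw [Finset.sum_comm, Finset.mul_sum]
    refine Finset.sum_congr rfl fun i _ => ?_
    rw [Finset.sum_comm, Finset.mul_sum]
    refine Finset.sum_congr rfl fun j _ => ?_
    simp only [trigSum, Finsupp.sum, Finset.sum_mul]
    rw [Finset.sum_comm, Finset.mul_sum]
    refine Finset.sum_congr rfl fun α hα => ?_
    simp only [map_sum, Finset.mul_sum, Finset.sum_mul]
    rw [Finset.sum_comm]
    rw [Finset.sum_congr rfl (fun l _ => Finset.sum_comm)]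
    rw [Finset.sum_comm]
    refine Finset.sum_congr rfl fun n hn => Finset.sum_congr rfl fun l hl => ?_
    have e : ∀ x, a i j α * monomial (α : Fin κ → ℤ) (t x) * (z i n * conj (monomial n (t x)))
          * conj (z j l * conj (monomial l (t x)))
        = a i j α * (z i n * conj (z j l)) * monomial ((α : Fin κ → ℤ) - (n - l)) (t x) := by
      intro x
      simp only [monomial_sub, map_mul, Complex.conj_conj]
      ring
    simp only [e]
    rw [← Finset.mul_sum, ht _ (hM i j α hα n hn l hl)]
    simp only [sub_eq_zero]
    split_ifs <;> ring
  have h0 := Finset.sum_nonneg fun x (_ : x ∈ Finset.univ) =>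
    ha (t x) fun i => ∑ n ∈ s, z i n * conj (monomial n (t x))
  rw [main] at h0
  exact nonneg_of_natCast_pow_mul_nonneg hM0 h0

/-- Only finitely many vectors occur, so each inner product is a finite sum over coordinates in an
orthonormal family, and the scalar case applies to each coordinate. -/
theorem toeplitz_inner_nonneg {K : Type*} [NormedAddCommGroup K] [InnerProductSpace ℂ K]
    (a : Fin m → Fin m → T →₀ ℂ)
    (ha : ∀ (t : Torus κ) (z : Fin m → ℂ), 0 ≤ ∑ i, ∑ j, trigSum (a i j) t * z i * conj (z j))
    (s : Finset (Fin κ → ℤ)) (v : Fin m → (Fin κ → ℤ) → K) :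
    0 ≤ ∑ i, ∑ j, (a i j).sum fun α c => c * ∑ n ∈ s, ∑ l ∈ s,
      if (α : Fin κ → ℤ) = n - l then inner ℂ (v j l) (v i n) else 0 := by
  obtain ⟨d, b, hb⟩ := exists_finite_expansion fun p : Fin m × s => v p.1 p.2
  have hin : ∀ i j, ∀ n ∈ s, ∀ l ∈ s, inner ℂ (v j l) (v i n)
      = ∑ k, inner ℂ (b k) (v i n) * conj (inner ℂ (b k) (v j l)) := by
    intro i j n hn l hl
    conv_lhs => rw [← hb (i, ⟨n, hn⟩)]
    simp only [inner_sum, inner_smul_right, inner_conj_symm]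
  have h0 := Finset.sum_nonneg (s := Finset.univ) fun (k : Fin d) _ =>
    toeplitz_nonneg a ha s fun i n => inner ℂ (b k) (v i n)
  convert! h0 using 1
  rw [Finset.sum_comm (s := (Finset.univ : Finset (Fin d)))]
  refine Finset.sum_congr rfl fun i _ => ?_
  rw [Finset.sum_comm (s := (Finset.univ : Finset (Fin d)))]
  refine Finset.sum_congr rfl fun j _ => ?_
  simp only [Finsupp.sum]
  rw [Finset.sum_comm]
  refine Finset.sum_congr rfl fun α _ => ?_
  rw [← Finset.mul_sum, Finset.sum_comm (s := (Finset.univ : Finset (Fin d)))]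
  congr 1
  refine Finset.sum_congr rfl fun n hn => ?_
  rw [Finset.sum_comm (s := (Finset.univ : Finset (Fin d)))]
  refine Finset.sum_congr rfl fun l hl => ?_
  split_ifs
  · exact hin i j n hn l hl
  · simp

/-- The number of ways to write `α` as a difference of two elements of the box `[0, N)^κ`,
divided by the size of the box. -/
noncomputable def fejerWeight (N : ℕ) (α : Fin κ → ℤ) : ℝ :=
  ∏ k, ((min (N : ℤ) (N + α k) - max 0 (α k)).toNat : ℝ) / N

/-- For given `n` only `l = n - α` contributes, so the sum counts the points of the intersection of
the box with its translate by `α`, again a box. -/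
theorem sum_box_eq (N : ℕ) (hN : 0 < N) (α : Fin κ → ℤ) (w : ℂ) :
    (∑ n ∈ Fintype.piFinset fun _ : Fin κ => Finset.Ico (0 : ℤ) N,
      ∑ l ∈ Fintype.piFinset fun _ : Fin κ => Finset.Ico (0 : ℤ) N,
        if α = n - l then w else 0) = (N : ℂ) ^ κ * (fejerWeight N α * w) := by
  classical
  have h1 : ∀ n : Fin κ → ℤ, (∑ l ∈ Fintype.piFinset fun _ : Fin κ => Finset.Ico (0 : ℤ) N,
      if α = n - l then w else 0)
      = if n - α ∈ Fintype.piFinset (fun _ : Fin κ => Finset.Ico (0 : ℤ) N) then w else 0 := by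
    intro n
    rw [← Finset.sum_ite_eq' _ (n - α) fun _ => w]
    refine Finset.sum_congr rfl fun l _ => if_congr ⟨fun h => ?_, fun h => ?_⟩ rfl rfl
    · rw [h]; abel
    · rw [h]; abel
  simp only [h1]
  rw [← Finset.sum_filter, Finset.sum_const]
  have h2 : (Fintype.piFinset fun _ : Fin κ => Finset.Ico (0 : ℤ) N).filter
      (fun n => n - α ∈ Fintype.piFinset (fun _ : Fin κ => Finset.Ico (0 : ℤ) N))
      = Fintype.piFinset fun k => Finset.Ico (max 0 (α k)) (min (N : ℤ) (N + α k)) := by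
    ext n
    simp only [Finset.mem_filter, Fintype.mem_piFinset, Finset.mem_Ico, ← forall_and,
      Pi.sub_apply]
    refine forall_congr' fun k => ?_
    omega
  rw [h2, Fintype.card_piFinset, fejerWeight, Finset.prod_div_distrib]
  simp only [Int.card_Ico, Finset.prod_const, Finset.card_univ, Fintype.card_fin, nsmul_eq_mul]
  have : (N : ℂ) ≠ 0 := by exact_mod_cast hN.ne'
  push_cast
  field_simp

theorem tendsto_fejerWeight (α : Fin κ → ℤ) :
    Filter.Tendsto (fun N => fejerWeight N α) Filter.atTop (nhds 1) := by
  have h : ∀ k, Filter.Tendsto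
      (fun N : ℕ => ((min (N : ℤ) (N + α k) - max 0 (α k)).toNat : ℝ) / N)
      Filter.atTop (nhds 1) := by
    intro k
    have h1 : Filter.Tendsto (fun N : ℕ => 1 - (|α k| : ℤ) / (N : ℝ)) Filter.atTop
        (nhds (1 - 0)) :=
      tendsto_const_nhds.sub (tendsto_const_div_atTop_nhds_zero_nat _)
    rw [sub_zero] at h1
    refine h1.congr' ?_
    -- Once `N > |α k|`, the interval has `N - |α k|` points and the truncation by `toNat` is
    -- harmless.
    filter_upwards [Filter.eventually_gt_atTop (α k).natAbs] with N hN
    have h2 : ((min (N : ℤ) (N + α k) - max 0 (α k)).toNat : ℤ) = N - |α k| := by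
      rcases abs_cases (α k) with ⟨h, _⟩ | ⟨h, _⟩ <;> rw [h] <;> omega
    have h3 : ((min (N : ℤ) (N + α k) - max 0 (α k)).toNat : ℝ) = N - (|α k| : ℤ) := by
      exact_mod_cast congrArg (Int.cast : ℤ → ℝ) h2
    have h4 : (N : ℝ) ≠ 0 := by
      have : 0 < N := by omega
      positivity
    rw [h3]
    field_simp
  have := tendsto_finsetProd Finset.univ fun k _ => h k
  simpa [fejerWeight] using this

/-- A family of vectors in a Hilbert space whose Gram matrix depends only on the difference of the
indices, for differences in `T`, turns nonnegative matrix trigonometric polynomials into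
nonnegative numbers. -/
theorem nonneg_of_translationInvariant {K : Type*} [NormedAddCommGroup K] [InnerProductSpace ℂ K]
    (a : Fin m → Fin m → T →₀ ℂ)
    (ha : ∀ (t : Torus κ) (z : Fin m → ℂ), 0 ≤ ∑ i, ∑ j, trigSum (a i j) t * z i * conj (z j))
    (v : Fin m → (Fin κ → ℤ) → K) (g : Fin m → Fin m → T → ℂ)
    (hg : ∀ i j (α : T) (n l : Fin κ → ℤ), n ∈ nonnegIndices κ → l ∈ nonnegIndices κ →
      (α : Fin κ → ℤ) = n - l → inner ℂ (v j l) (v i n) = g i j α) :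
    0 ≤ ∑ i, ∑ j, (a i j).sum fun α c => c * g i j α := by
  have lim : Filter.Tendsto (fun N => ∑ i, ∑ j, (a i j).sum fun α c =>
      c * ((fejerWeight N (α : Fin κ → ℤ) : ℂ) * g i j α)) Filter.atTop
      (nhds (∑ i, ∑ j, (a i j).sum fun α c => c * g i j α)) := by
    refine tendsto_finsetSum _ fun i _ => tendsto_finsetSum _ fun j _ =>
      tendsto_finsetSum _ fun α _ => ?_
    have h1 := (Complex.continuous_ofReal.tendsto 1).comp
      (tendsto_fejerWeight (α : Fin κ → ℤ))
    have := (h1.mul_const (g i j α)).const_mul (a i j α)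
    simpa using this
  refine ge_of_tendsto lim ?_
  filter_upwards [Filter.eventually_gt_atTop 0] with N hN
  have h0 := toeplitz_inner_nonneg a ha
    (Fintype.piFinset fun _ : Fin κ => Finset.Ico (0 : ℤ) N) v
  refine nonneg_of_natCast_pow_mul_nonneg (k := κ) hN (h0.trans_eq ?_)
  simp only [Finset.mul_sum, Finsupp.sum]
  refine Finset.sum_congr rfl fun i _ => Finset.sum_congr rfl fun j _ =>
    Finset.sum_congr rfl fun α _ => ?_
  rw [mul_left_comm, ← sum_box_eq N hN, Finset.mul_sum]
  refine Finset.sum_congr rfl fun n hn => ?_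
  rw [Finset.mul_sum]
  refine Finset.sum_congr rfl fun l hl => ?_
  rw [Fintype.mem_piFinset] at hn hl
  split_ifs with h
  · rw [hg i j α n l (fun k => (Finset.mem_Ico.1 (hn k)).1)
      (fun k => (Finset.mem_Ico.1 (hl k)).1) h]
  · rfl

end Averaging

/-! ### From a dilation to positivity -/

section Operators

variable {H : Type u} [NormedAddCommGroup H] [InnerProductSpace ℂ H] [CompleteSpace H] {κ : ℕ}

theorem signedPow_of_nonneg (A : Fin κ → H →L[ℂ] H) {α : signedIndices κ}
    (h : (α : Fin κ → ℤ) ∈ nonnegIndices κ) :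
    signedPow A α = multiPow A fun i => ((α : Fin κ → ℤ) i).natAbs := by
  rw [signedPow, if_pos h]

/-- The two cases of the definition overlap only at `α = 0`, where both give the identity. -/
theorem signedPow_of_nonpos (A : Fin κ → H →L[ℂ] H) {α : signedIndices κ}
    (h : (α : Fin κ → ℤ) ∈ nonposIndices κ) :
    signedPow A α = multiPow (fun i => ContinuousLinearMap.adjoint (A i))
      fun i => ((α : Fin κ → ℤ) i).natAbs := by
  by_cases h' : (α : Fin κ → ℤ) ∈ nonnegIndices κ
  · have : (fun i => ((α : Fin κ → ℤ) i).natAbs) = 0 := by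
      funext i
      have h1 := h i
      have h2 := h' i
      simp only [Pi.zero_apply]
      omega
    rw [signedPow_of_nonneg A h', this, multiPow_zero, multiPow_zero]
  · rw [signedPow, if_neg h']

theorem HasUnitaryPowerDilation.operatorSum_nonneg {A : Fin κ → H →L[ℂ] H}
    (hA : HasUnitaryPowerDilation A) (hc : ∀ i j, Commute (A i) (A j)) {m : ℕ}
    (a : Fin m → Fin m → signedIndices κ →₀ ℂ)
    (ha : ∀ (t : Torus κ) (z : Fin m → ℂ), 0 ≤ ∑ i, ∑ j, trigSum (a i j) t * z i * conj (z j))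
    (f : Fin m → H) : 0 ≤ operatorSum A a f := by
  obtain ⟨K, _, _, _, V, U, hU, hcU, hd⟩ := hA
  have dil : ∀ (α : Fin κ → ℕ) (x y : H),
      inner ℂ (V y) (multiPow U α (V x)) = inner ℂ y (multiPow A α x) := by
    intro α x y
    rw [← V.inner_map_map y, hd, ← Submodule.inner_starProjection_left_eq_right,
      Submodule.starProjection_eq_self_iff.2 (show V y ∈ V.toLinearMap.range from
        LinearMap.mem_range_self _ y)]
  have iso : ∀ (α : Fin κ → ℕ) (x y : K),
      inner ℂ (multiPow U α x) (multiPow U α y) = inner ℂ x y := fun α x y =>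
    ContinuousLinearMap.inner_map_map_of_mem_unitary (multiPow_mem (S := unitary _) hU α) x y
  refine nonneg_of_translationInvariant a ha
    (fun i n => multiPow U (fun k => (n k).natAbs) (V (f i)))
    (fun i j α => inner ℂ (f j) (signedPow A α (f i))) ?_
  intro i j α n l hn hl hα
  have hα' : ∀ k, (α : Fin κ → ℤ) k = n k - l k := fun k => congrFun hα k
  -- For `α ≥ 0` one has `n = l + α`, and the isometry `U^l` cancels. For `α ≤ 0` one has `l = n +
  -- |α|`, so the power stays on the other side of the inner product and must be moved across as an
  -- adjoint; here the commutativity of `A` is needed.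
  rcases α.2 with h | h
  · have e : (fun k => (n k).natAbs)
        = (fun k => (l k).natAbs) + fun k => ((α : Fin κ → ℤ) k).natAbs := by
      funext k
      have h1 := hn k; have h2 := hl k; have h3 := h k; have h4 := hα' k
      simp only [Pi.add_apply]
      omega
    rw [e, multiPow_add hcU, mul_apply_eq_comp, iso, dil, signedPow_of_nonneg A h]
  · have e : (fun k => (l k).natAbs)
        = (fun k => (n k).natAbs) + fun k => ((α : Fin κ → ℤ) k).natAbs := by
      funext k
      have h1 := hn k; have h2 := hl k; have h3 := h k; have h4 := hα' k
      simp only [Pi.add_apply]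
      omega
    rw [e, multiPow_add hcU, mul_apply_eq_comp, iso, signedPow_of_nonpos A h,
      ← inner_conj_symm, dil, inner_conj_symm]
    have := star_multiPow hc fun k => ((α : Fin κ → ℤ) k).natAbs
    simp only [ContinuousLinearMap.star_eq_adjoint] at this
    rw [← this, ContinuousLinearMap.adjoint_inner_right]

end Operators

/-! ### Unitary groups on completions -/

section Completion

open UniformSpace

/-- A group of inner product preserving linear maps extends to a group of unitary operators on the
completion. -/
theorem exists_unitary_completion {W G : Type*} [SeminormedAddCommGroup W] [InnerProductSpace ℂ W]
    [Group G] (S : G →* Module.End ℂ W)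
    (hS : ∀ g x y, inner ℂ (S g x) (S g y) = inner ℂ x y) :
    ∃ ρ : G →* (Completion W →L[ℂ] Completion W),
      (∀ g, ρ g ∈ unitary (Completion W →L[ℂ] Completion W)) ∧
        ∀ g (x : W), ρ g (x : Completion W) = (S g x : W) := by
  have hn : ∀ g x, ‖S g x‖ ≤ 1 * ‖x‖ := by
    intro g x
    rw [one_mul, norm_eq_sqrt_re_inner (𝕜 := ℂ), norm_eq_sqrt_re_inner (𝕜 := ℂ) x, hS]
  let R : G → (Completion W →L[ℂ] Completion W) := fun g =>
    ((S g).mkContinuous 1 (hn g)).completion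
  have hR : ∀ g (x : W), R g (x : Completion W) = (S g x : W) := by
    intro g x
    simp [R]
  have ext : ∀ {P Q : Completion W →L[ℂ] Completion W},
      (∀ x : W, P (x : Completion W) = Q (x : Completion W)) → P = Q := by
    intro P Q h
    ext x
    induction x using Completion.induction_on with
    | hp => exact isClosed_eq P.continuous Q.continuous
    | ih a => exact h a
  let ρ : G →* (Completion W →L[ℂ] Completion W) :=
    { toFun := R
      map_one' := ext fun x => by rw [hR]; simp
      map_mul' := fun g h => ext fun x => by
        rw [mul_apply_eq_comp, hR, hR, hR]; simp }
  have hρ : ∀ g (x : W), ρ g (x : Completion W) = (S g x : W) := hR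
  have iso : ∀ g (x y : Completion W), inner ℂ (ρ g x) (ρ g y) = inner ℂ x y := by
    intro g x y
    induction x, y using Completion.induction_on₂ with
    | hp => apply isClosed_eq <;> fun_prop
    | ih a b => rw [hρ, hρ, Completion.inner_coe, Completion.inner_coe, hS]
  refine ⟨ρ, fun g => ?_, hρ⟩
  -- Preservation of inner products only makes `ρ g` an isometry; the right inverse `ρ g⁻¹` makes it
  -- unitary.
  have h1 : star (ρ g) * ρ g = 1 := by
    refine ContinuousLinearMap.ext fun x => ext_inner_left ℂ fun y => ?_
    rw [mul_apply_eq_comp, ContinuousLinearMap.star_eq_adjoint,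
      ContinuousLinearMap.adjoint_inner_right, iso, one_apply_eq_self]
  refine Unitary.mem_iff.2 ⟨h1, ?_⟩
  have h2 : ρ g * ρ g⁻¹ = 1 := by rw [← map_mul, mul_inv_cancel, map_one]
  have h3 : star (ρ g) = ρ g⁻¹ := by
    rw [← mul_one (star (ρ g)), ← h2, ← mul_assoc, h1, one_mul]
  rw [h3, h2]

end Completion

/-! ### Formal symbols, sums of squares and the extension of functionals -/

section Formal

variable {H : Type u} {κ : ℕ}

/-- The formal adjoint. -/
noncomputable def formStar :
    (((Fin κ → ℤ) × H × H) →₀ ℂ) →+ (((Fin κ → ℤ) × H × H) →₀ ℂ) :=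
  Finsupp.liftAddHom fun p =>
    (Finsupp.singleAddHom (-p.1, p.2.2, p.2.1)).comp (starRingEnd ℂ).toAddMonoidHom

@[simp]
theorem formStar_single (p : (Fin κ → ℤ) × H × H) (c : ℂ) :
    formStar (Finsupp.single p c) = Finsupp.single (-p.1, p.2.2, p.2.1) (conj c) := by
  simp [formStar]

/-- The formal linear combinations of symbols `λ^α ⊗ f ⊗ g` with `α ∈ T`. -/
noncomputable def formSupported (H : Type u) (T : Set (Fin κ → ℤ)) :
    Submodule ℂ (((Fin κ → ℤ) × H × H) →₀ ℂ) :=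
  Finsupp.supported ℂ ℂ {p | p.1 ∈ T}

theorem single_mem_formSupported {T : Set (Fin κ → ℤ)} {α : Fin κ → ℤ} (hα : α ∈ T) (f g : H)
    (c : ℂ) : Finsupp.single (α, f, g) c ∈ formSupported H T :=
  Finsupp.single_mem_supported ℂ c hα

theorem formStar_mem {T : Set (Fin κ → ℤ)} (hT : ∀ α ∈ T, -α ∈ T)
    {e : ((Fin κ → ℤ) × H × H) →₀ ℂ} (he : e ∈ formSupported H T) :
    formStar e ∈ formSupported H T := by
  rw [← e.sum_single, Finsupp.sum, map_sum]
  refine Submodule.sum_mem _ fun p hp => ?_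
  rw [formStar_single]
  exact single_mem_formSupported (hT _ (he hp)) _ _ _

variable [NormedAddCommGroup H] [InnerProductSpace ℂ H]

/-- The value at a point of the torus of a trigonometric polynomial with coefficients in `H`. -/
noncomputable def vectorEval : ((Fin κ → ℤ) →₀ H) →ₗ[ℂ] (Torus κ → H) :=
  Finsupp.lsum ℂ fun n => LinearMap.pi fun t => monomial n t • LinearMap.id

theorem vectorEval_apply (p : (Fin κ → ℤ) →₀ H) (t : Torus κ) :
    vectorEval p t = p.sum fun n f => monomial n t • f := by
  simp [vectorEval, Finsupp.sum, Finset.sum_apply]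

@[simp]
theorem vectorEval_single (n : Fin κ → ℤ) (f : H) (t : Torus κ) :
    vectorEval (Finsupp.single n f) t = monomial n t • f := by
  rw [vectorEval_apply, Finsupp.sum_single_index (by simp)]

/-- Formal linear combinations of the symbols `λ^α ⊗ f ⊗ g`, evaluated as sesquilinear forms which
depend on a point of the torus. -/
noncomputable def formEval :
    (((Fin κ → ℤ) × H × H) →₀ ℂ) →ₗ[ℂ] (Torus κ → H → H → ℂ) :=
  Finsupp.linearCombination ℂ fun p t x y =>
    monomial p.1 t * (inner ℂ x p.2.1 * inner ℂ p.2.2 y)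

@[simp]
theorem formEval_single (p : (Fin κ → ℤ) × H × H) (c : ℂ) (t : Torus κ) (x y : H) :
    formEval (Finsupp.single p c) t x y
      = c * (monomial p.1 t * (inner ℂ x p.2.1 * inner ℂ p.2.2 y)) := by
  simp [formEval]

theorem formEval_apply (e : ((Fin κ → ℤ) × H × H) →₀ ℂ) (t : Torus κ) (x y : H) :
    formEval e t x y
      = e.sum fun p c => c * (monomial p.1 t * (inner ℂ x p.2.1 * inner ℂ p.2.2 y)) := by
  simp [formEval, Finsupp.linearCombination_apply, Finsupp.sum, Finset.sum_apply]

theorem formEval_formStar (e : ((Fin κ → ℤ) × H × H) →₀ ℂ) (t : Torus κ) (x y : H) :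
    formEval (formStar e) t x y = conj (formEval e t y x) := by
  induction e using Finsupp.induction_linear with
  | zero => simp
  | add e e' h h' => simp [h, h']
  | single p c =>
    simp only [formStar_single, formEval_single, map_mul, conj_monomial, inner_conj_symm]
    ring

/-- The sum of the hermitian squares of trigonometric polynomials with coefficients in `H`. -/
noncomputable def squareSum (l : List ((Fin κ → ℤ) →₀ H)) (t : Torus κ) (x y : H) : ℂ :=
  (l.map fun q => inner ℂ x (vectorEval q t) * inner ℂ (vectorEval q t) y).sum

@[simp]
theorem squareSum_nil (t : Torus κ) (x y : H) :
    squareSum ([] : List ((Fin κ → ℤ) →₀ H)) t x y = 0 := rfl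

@[simp]
theorem squareSum_cons (q : (Fin κ → ℤ) →₀ H) (l : List ((Fin κ → ℤ) →₀ H)) (t : Torus κ)
    (x y : H) : squareSum (q :: l) t x y
      = inner ℂ x (vectorEval q t) * inner ℂ (vectorEval q t) y + squareSum l t x y := rfl

theorem squareSum_append (l l' : List ((Fin κ → ℤ) →₀ H)) (t : Torus κ) (x y : H) :
    squareSum (l ++ l') t x y = squareSum l t x y + squareSum l' t x y := by
  simp [squareSum]

theorem conj_squareSum (l : List ((Fin κ → ℤ) →₀ H)) (t : Torus κ) (x y : H) :
    conj (squareSum l t x y) = squareSum l t y x := by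
  induction l with
  | nil => simp
  | cons q l ih =>
    rw [squareSum_cons, squareSum_cons, map_add, ih, map_mul, inner_conj_symm, inner_conj_symm]
    ring

theorem squareSum_map_smul (r : ℝ) (l : List ((Fin κ → ℤ) →₀ H)) (t : Torus κ) (x y : H) :
    squareSum (l.map fun q => (r : ℂ) • q) t x y = (r : ℂ) ^ 2 * squareSum l t x y := by
  induction l with
  | nil => simp
  | cons q l ih =>
    rw [List.map_cons, squareSum_cons, squareSum_cons, ih, map_smul, Pi.smul_apply,
      inner_smul_right, inner_smul_left, Complex.conj_ofReal]
    ring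

/-- The formal linear combinations whose hermitian part is a sum of hermitian squares. -/
noncomputable def squareCone (κ : ℕ) (H : Type u) [NormedAddCommGroup H] [InnerProductSpace ℂ H] :
    PointedCone ℝ (((Fin κ → ℤ) × H × H) →₀ ℂ) where
  carrier := {e | ∃ l : List ((Fin κ → ℤ) →₀ H), ∀ t x y,
    formEval e t x y + conj (formEval e t y x) = squareSum l t x y}
  zero_mem' := ⟨[], by simp⟩
  add_mem' := by
    rintro e e' ⟨l, hl⟩ ⟨l', hl'⟩
    refine ⟨l ++ l', fun t x y => ?_⟩
    rw [squareSum_append, ← hl, ← hl']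
    simp only [map_add, Pi.add_apply]
    ring
  smul_mem' := by
    rintro ⟨r, hr⟩ e ⟨l, hl⟩
    refine ⟨l.map fun q => ((√r : ℝ) : ℂ) • q, fun t x y => ?_⟩
    rw [squareSum_map_smul, ← hl, ← Complex.ofReal_pow, Real.sq_sqrt hr]
    have : (⟨r, hr⟩ : {c : ℝ // 0 ≤ c}) • e = (r : ℂ) • e := by
      ext p
      exact Complex.real_smul
    rw [this]
    simp only [map_smul, Pi.smul_apply, smul_eq_mul, map_mul, Complex.conj_ofReal]
    ring

theorem mem_squareCone {e : ((Fin κ → ℤ) × H × H) →₀ ℂ} :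
    e ∈ squareCone κ H ↔ ∃ l : List ((Fin κ → ℤ) →₀ H), ∀ t x y,
      formEval e t x y + conj (formEval e t y x) = squareSum l t x y := Iff.rfl

/-- The formal version of the hermitian square of `λ^α f + g`. -/
noncomputable def formSquare (α : Fin κ → ℤ) (f g : H) : ((Fin κ → ℤ) × H × H) →₀ ℂ :=
  Finsupp.single (0, f, f) 1 + Finsupp.single (0, g, g) 1 + Finsupp.single (α, f, g) 1
    + Finsupp.single (-α, g, f) 1

theorem formEval_formSquare (α : Fin κ → ℤ) (f g : H) (t : Torus κ) (x y : H) :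
    formEval (formSquare α f g) t x y
      = squareSum [Finsupp.single α f + Finsupp.single 0 g] t x y := by
  simp only [formSquare, map_add, Pi.add_apply, formEval_single, squareSum_cons, squareSum_nil,
    vectorEval_single, monomial_zero, inner_add_left, inner_add_right, inner_smul_left,
    inner_smul_right, one_smul, ← conj_monomial]
  linear_combination (-inner ℂ x f * inner ℂ f y) * monomial_mul_conj α t

/-- The functional `λ^α ⊗ f ⊗ g ↦ ⟨φ(α) f, g⟩`. -/
noncomputable def formFunctional (φ : (Fin κ → ℤ) → H →L[ℂ] H) :
    (((Fin κ → ℤ) × H × H) →₀ ℂ) →ₗ[ℂ] ℂ :=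
  Finsupp.linearCombination ℂ fun p => inner ℂ p.2.2 (φ p.1 p.2.1)

@[simp]
theorem formFunctional_single (φ : (Fin κ → ℤ) → H →L[ℂ] H) (p : (Fin κ → ℤ) × H × H) (c : ℂ) :
    formFunctional φ (Finsupp.single p c) = c * inner ℂ p.2.2 (φ p.1 p.2.1) := by
  simp [formFunctional]

/-- An operator function on `T` is positive on `T` if the functional which it induces on the
symbols with index in `T` is nonnegative on sums of hermitian squares. -/
def IsSquarePositive (T : Set (Fin κ → ℤ)) (φ : (Fin κ → ℤ) → H →L[ℂ] H) : Prop :=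
  ∀ e ∈ formSupported H T, ∀ l : List ((Fin κ → ℤ) →₀ H),
    (∀ t x y, formEval e t x y = squareSum l t x y) → 0 ≤ formFunctional φ e

/-- The functional is real on the hermitian square of `λ^α c f + g`. The diagonal terms are norms,
so the sum of the two cross terms is real for every `c`; the values `c = 1` and `c = i` determine
the adjoint relation. -/
theorem IsSquarePositive.adjoint_eq [CompleteSpace H] {T : Set (Fin κ → ℤ)}
    {φ : (Fin κ → ℤ) → H →L[ℂ] H} (h : IsSquarePositive T φ) (h0 : (0 : Fin κ → ℤ) ∈ T)
    (hφ : φ 0 = 1) {α : Fin κ → ℤ} (hα : α ∈ T) (hα' : -α ∈ T) :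
    φ (-α) = ContinuousLinearMap.adjoint (φ α) := by
  refine ContinuousLinearMap.ext fun g => ext_inner_left ℂ fun f => ?_
  rw [ContinuousLinearMap.adjoint_inner_right, ← inner_conj_symm (φ α f) g]
  have key : ∀ c : ℂ, (c * inner ℂ g (φ α f) + conj c * inner ℂ f (φ (-α) g)).im = 0 := by
    intro c
    have := h (formSquare α (c • f) g)
      (add_mem (add_mem (add_mem (single_mem_formSupported h0 _ _ _)
        (single_mem_formSupported h0 _ _ _)) (single_mem_formSupported hα _ _ _))
        (single_mem_formSupported hα' _ _ _)) _ (formEval_formSquare α (c • f) g)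
    have h2 := (Complex.nonneg_iff.1 this).2
    simp only [formSquare, map_add, formFunctional_single, hφ, one_apply_eq_self,
      inner_self_eq_norm_sq_to_K, map_smul, inner_smul_right, inner_smul_left, one_mul] at h2
    have e : ∀ w : H, ((‖w‖ : ℂ) ^ 2).im = 0 := fun w => by
      rw [← Complex.ofReal_pow]; exact Complex.ofReal_im _
    simpa [e] using h2.symm
  have k1 := key 1
  have k2 := key Complex.I
  simp only [map_one, one_mul, Complex.add_im, Complex.conj_I, Complex.I_mul_im, neg_mul,
    Complex.neg_im] at k1 k2
  refine Complex.ext ?_ ?_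
  · rw [Complex.conj_re]; linarith
  · rw [Complex.conj_im]; linarith

theorem formFunctional_formStar [CompleteSpace H] {φ : (Fin κ → ℤ) → H →L[ℂ] H}
    (hφ : ∀ α, φ (-α) = ContinuousLinearMap.adjoint (φ α))
    (e : ((Fin κ → ℤ) × H × H) →₀ ℂ) :
    formFunctional φ (formStar e) = conj (formFunctional φ e) := by
  induction e using Finsupp.induction_linear with
  | zero => simp
  | add e e' h h' => simp [h, h']
  | single p c =>
    simp only [formStar_single, formFunctional_single, map_mul, hφ,
      ContinuousLinearMap.adjoint_inner_right, inner_conj_symm]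

/-- Every formal linear combination is dominated by one with index `0`. -/
theorem exists_add_mem_squareCone {T : Set (Fin κ → ℤ)} (h0 : (0 : Fin κ → ℤ) ∈ T)
    (e : ((Fin κ → ℤ) × H × H) →₀ ℂ) :
    ∃ x ∈ formSupported H T, x + e ∈ squareCone κ H := by
  induction e using Finsupp.induction_linear with
  | zero => exact ⟨0, Submodule.zero_mem _, by simp⟩
  | add e e' h h' =>
    obtain ⟨x, hx, hxe⟩ := h
    obtain ⟨x', hx', hxe'⟩ := h'
    refine ⟨x + x', add_mem hx hx', ?_⟩
    rw [add_add_add_comm]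
    exact add_mem hxe hxe'
  | single p c =>
    obtain ⟨α, f, g⟩ := p
    -- Passing to the hermitian part doubles the two index-`0` terms. One copy of each completes the
    -- cross terms to the square of `λ^α c f + g`; the other copy is a square by itself.
    refine ⟨Finsupp.single (0, c • f, c • f) 1 + Finsupp.single (0, g, g) 1,
      add_mem (single_mem_formSupported h0 _ _ _) (single_mem_formSupported h0 _ _ _),
      mem_squareCone.2 ⟨[Finsupp.single α (c • f) + Finsupp.single 0 g, Finsupp.single 0 (c • f),
        Finsupp.single 0 g], fun t x y => ?_⟩⟩
    simp only [map_add, Pi.add_apply, formEval_single, squareSum_cons, squareSum_nil,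
      vectorEval_single, monomial_zero, inner_add_left, inner_add_right, inner_smul_left,
      inner_smul_right, one_smul, map_mul, map_one, inner_conj_symm, Complex.conj_conj]
    linear_combination
      (-(c * conj c * inner ℂ x f * inner ℂ f y)) * monomial_mul_conj α t

/-- A function which is positive on `T` gives rise to a positive functional on all symbols. -/
theorem IsSquarePositive.exists_functional [CompleteSpace H] {T : Set (Fin κ → ℤ)}
    {φ : (Fin κ → ℤ) → H →L[ℂ] H} (h : IsSquarePositive T φ) (h0 : (0 : Fin κ → ℤ) ∈ T)
    (hT : ∀ α ∈ T, -α ∈ T) (hφ : ∀ α, φ (-α) = ContinuousLinearMap.adjoint (φ α)) :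
    ∃ Λ : (((Fin κ → ℤ) × H × H) →₀ ℂ) →ₗ[ℂ] ℂ,
      (∀ e ∈ formSupported H T, Λ e = formFunctional φ e) ∧
      (∀ e (l : List ((Fin κ → ℤ) →₀ H)),
        (∀ t x y, formEval e t x y = squareSum l t x y) → 0 ≤ Λ e) ∧
      (∀ e e', (∀ t x y, formEval e' t x y = conj (formEval e t y x)) → Λ e' = conj (Λ e)) := by
  -- The Riesz theorem is a real statement, so the real part is extended and complexified
  -- afterwards.
  let F : (((Fin κ → ℤ) × H × H) →₀ ℂ) →ₗ.[ℝ] ℝ :=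
    { domain := (formSupported H T).restrictScalars ℝ
      toFun := (Complex.reLm ∘ₗ (formFunctional φ).restrictScalars ℝ).domRestrict _ }
  have hF : ∀ x : F.domain, F x = (formFunctional φ x).re := fun x => rfl
  obtain ⟨L, hL, hpos⟩ := riesz_extension (squareCone κ H) F
    (by
      rintro x ⟨l, hl⟩
      have hx : (x : ((Fin κ → ℤ) × H × H) →₀ ℂ) ∈ formSupported H T := x.2
      -- Membership in the cone concerns only the hermitian part, so positivity is applied to `x`
      -- plus its formal adjoint, which the symmetry of `T` keeps in the domain; its value is twice
      -- the real part.
      have := h _ (add_mem hx (formStar_mem hT hx)) l fun t y z => by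
        rw [← hl, map_add, Pi.add_apply, Pi.add_apply, Pi.add_apply, formEval_formStar]
      rw [map_add, formFunctional_formStar hφ, Complex.add_conj, Complex.zero_le_real] at this
      rw [hF]
      linarith)
    (fun y => by
      obtain ⟨x, hx, hxy⟩ := exists_add_mem_squareCone h0 y
      exact ⟨⟨x, hx⟩, hxy⟩)
  -- Both `e` and `-e` lie in the cone, with the empty sum of squares. Hence `L` depends only on the
  -- hermitian part of the evaluation.
  have hzero : ∀ e, (∀ t x y, formEval e t x y + conj (formEval e t y x) = 0) → L e = 0 := by
    intro e he
    have h1 := hpos e (mem_squareCone.2 ⟨[], he⟩)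
    have h2 := hpos (-e) (mem_squareCone.2 ⟨[], fun t x y => by
      rw [squareSum_nil, map_neg, Pi.neg_apply, Pi.neg_apply, Pi.neg_apply,
        Pi.neg_apply, Pi.neg_apply, map_neg, ← neg_add, he, neg_zero]⟩)
    rw [map_neg] at h2
    linarith
  have hΛ : ∀ e, (Module.Dual.extendRCLike (𝕜 := ℂ) L) e
      = (L e : ℂ) - Complex.I * (L (Complex.I • e) : ℂ) := fun e =>
    Module.Dual.extendRCLike_apply L e
  have hsymm : ∀ e e', (∀ t x y, formEval e' t x y = conj (formEval e t y x)) →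
      (Module.Dual.extendRCLike (𝕜 := ℂ) L) e' = conj ((Module.Dual.extendRCLike (𝕜 := ℂ) L) e) := by
    intro e e' he
    have h1 : L (e' - e) = 0 := hzero _ fun t x y => by
      simp only [map_sub, Pi.sub_apply, he, Complex.conj_conj]
      ring
    have h2 : L (Complex.I • e' + Complex.I • e) = 0 := hzero _ fun t x y => by
      simp only [map_add, Pi.add_apply, map_smul, Pi.smul_apply, he, smul_eq_mul, map_mul,
        Complex.conj_I, Complex.conj_conj]
      ring
    rw [map_sub, sub_eq_zero] at h1
    rw [map_add, add_eq_zero_iff_eq_neg] at h2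
    rw [hΛ, hΛ, h1, h2]
    simp
  refine ⟨Module.Dual.extendRCLike (𝕜 := ℂ) L, fun e he => ?_, fun e l he => ?_, hsymm⟩
  · have h1 : L e = (formFunctional φ e).re := hL ⟨e, he⟩
    have h2 : L (Complex.I • e) = (formFunctional φ (Complex.I • e)).re :=
      hL ⟨Complex.I • e, (formSupported H T).smul_mem _ he⟩
    rw [hΛ, h1, h2, map_smul]
    apply Complex.ext <;> simp
  -- A sum of squares is hermitian, so adding its adjoint doubles it; hence the list `l ++ l`.
  · have h1 : 0 ≤ L e := hpos e (mem_squareCone.2 ⟨l ++ l, fun t x y => by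
      rw [squareSum_append, he, he, conj_squareSum]⟩)
    have h2 := hsymm e e fun t x y => by rw [he, he, conj_squareSum]
    have h3 : ((Module.Dual.extendRCLike (𝕜 := ℂ) L) e).re = L e := by
      rw [hΛ]; simp
    exact Complex.nonneg_iff.2 ⟨by rw [h3]; linarith [h1], (Complex.conj_eq_iff_im.1 h2.symm).symm⟩

end Formal

/-! ### The GNS construction -/

section Dilation

variable {H : Type u} [NormedAddCommGroup H] [InnerProductSpace ℂ H] {κ : ℕ}

/-- The formal version of the product of `p` and the adjoint of `q`. -/
noncomputable def formPair (p q : (Fin κ → ℤ) →₀ H) : ((Fin κ → ℤ) × H × H) →₀ ℂ :=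
  p.sum fun n f => q.sum fun l g => Finsupp.single (n - l, f, g) 1

theorem formEval_formPair (p q : (Fin κ → ℤ) →₀ H) (t : Torus κ) (x y : H) :
    formEval (formPair p q) t x y = inner ℂ x (vectorEval p t) * inner ℂ (vectorEval q t) y := by
  simp only [formPair, Finsupp.sum, map_sum, Finset.sum_apply, formEval_single, vectorEval_apply,
    inner_sum, sum_inner, Finset.sum_mul, Finset.mul_sum, inner_smul_left, inner_smul_right,
    monomial_sub]
  rw [Finset.sum_comm]
  refine Finset.sum_congr rfl fun l _ => Finset.sum_congr rfl fun n _ => ?_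
  ring

/-- Multiplication of trigonometric polynomials with a monomial. -/
noncomputable def translate (κ : ℕ) (H : Type u) [NormedAddCommGroup H] [InnerProductSpace ℂ H] :
    Multiplicative (Fin κ → ℤ) →* Module.End ℂ ((Fin κ → ℤ) →₀ H) where
  toFun n := Finsupp.lmapDomain H ℂ fun l => n.toAdd + l
  map_one' := by
    refine LinearMap.ext fun p => ?_
    simp only [toAdd_one, zero_add]
    exact Finsupp.mapDomain_id
  map_mul' n l := by
    refine LinearMap.ext fun p => ?_
    rw [Module.End.mul_apply, Finsupp.lmapDomain_apply, Finsupp.lmapDomain_apply,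
      Finsupp.lmapDomain_apply, ← Finsupp.mapDomain_comp]
    exact congrArg (fun F => Finsupp.mapDomain F p) (funext fun k => add_assoc _ _ _)

@[simp]
theorem translate_single (n : Multiplicative (Fin κ → ℤ)) (l : Fin κ → ℤ) (f : H) :
    translate κ H n (Finsupp.single l f) = Finsupp.single (n.toAdd + l) f := by
  simp [translate]

theorem vectorEval_translate (n : Multiplicative (Fin κ → ℤ)) (p : (Fin κ → ℤ) →₀ H)
    (t : Torus κ) : vectorEval (translate κ H n p) t = monomial n.toAdd t • vectorEval p t := by
  induction p using Finsupp.induction_linear with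
  | zero => simp
  | add p q hp hq => simp [hp, hq]
  | single l f => simp [monomial_add, mul_smul]

/-- An operator function which is positive on a symmetric set `T` is, on `T`, the compression of a
unitary representation of `ℤ^κ`. -/
theorem IsSquarePositive.exists_representation [CompleteSpace H] {T : Set (Fin κ → ℤ)}
    {φ : (Fin κ → ℤ) → H →L[ℂ] H} (h : IsSquarePositive T φ) (h0 : (0 : Fin κ → ℤ) ∈ T)
    (hT : ∀ α ∈ T, -α ∈ T) (hφ0 : φ 0 = 1)
    (hφ : ∀ α, φ (-α) = ContinuousLinearMap.adjoint (φ α)) :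
    ∃ (K : Type u) (_ : NormedAddCommGroup K) (_ : InnerProductSpace ℂ K) (_ : CompleteSpace K)
      (V : H →ₗᵢ[ℂ] K) (ρ : Multiplicative (Fin κ → ℤ) →* (K →L[ℂ] K)),
      (∀ n, ρ n ∈ unitary (K →L[ℂ] K)) ∧ ∀ α ∈ T, ∀ f g : H,
        inner ℂ (V g) (ρ (Multiplicative.ofAdd α) (V f)) = inner ℂ g (φ α f) := by
  obtain ⟨Λ, hΛ, hpos, hsymm⟩ := h.exists_functional h0 hT hφ
  -- `Λ` sees only the evaluation of a symbol. This is needed because the symbols are free in `f`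
  -- and `g`: `formPair` is sesquilinear only after evaluation.
  have hcongr : ∀ {e e'}, (∀ t x y, formEval e t x y = formEval e' t x y) → Λ e = Λ e' := by
    intro e e' he
    have := hsymm (formStar e) e' fun t x y => by rw [formEval_formStar, Complex.conj_conj, he]
    rw [this]
    exact hsymm _ _ fun t x y => by rw [formEval_formStar, Complex.conj_conj]
  let c : PreInnerProductSpace.Core ℂ ((Fin κ → ℤ) →₀ H) :=
    { inner := fun p q => Λ (formPair q p)
      conj_inner_symm := fun p q => (hsymm _ _ fun t x y => by
        rw [formEval_formPair, formEval_formPair, map_mul, inner_conj_symm, inner_conj_symm,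
          mul_comm]).symm
      re_inner_nonneg := fun p => (Complex.nonneg_iff.1 (hpos (formPair p p) [p] fun t x y => by
        rw [formEval_formPair, squareSum_cons, squareSum_nil, add_zero])).1
      add_left := fun p q r => by
        rw [← map_add]
        refine hcongr fun t x y => ?_
        simp only [map_add, Pi.add_apply, formEval_formPair, inner_add_left, mul_add]
      smul_left := fun p q a => by
        rw [← smul_eq_mul, ← map_smul]
        refine hcongr fun t x y => ?_
        simp only [map_smul, Pi.smul_apply, formEval_formPair, inner_smul_left, smul_eq_mul]
        ring }
  let _ : SeminormedAddCommGroup ((Fin κ → ℤ) →₀ H) :=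
    InnerProductSpace.Core.toSeminormedAddCommGroup (c := c)
  let _ : InnerProductSpace ℂ ((Fin κ → ℤ) →₀ H) := InnerProductSpace.ofCore c
  have hinner : ∀ p q : (Fin κ → ℤ) →₀ H, inner ℂ p q = Λ (formPair q p) := fun _ _ => rfl
  have hsingle : ∀ α ∈ T, ∀ f g : H,
      inner ℂ (Finsupp.single 0 g) (Finsupp.single α f) = inner ℂ g (φ α f) := by
    intro α hα f g
    have : Λ (Finsupp.single (α, f, g) 1) = inner ℂ g (φ α f) := by
      rw [hΛ _ (single_mem_formSupported hα _ _ _), formFunctional_single, one_mul]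
    rw [hinner, ← this]
    refine hcongr fun t x y => ?_
    simp [formEval_formPair, monomial_zero, mul_assoc]
  obtain ⟨ρ, hρ, hρS⟩ := exists_unitary_completion (translate κ H) fun n p q => by
    rw [hinner, hinner]
    refine hcongr fun t x y => ?_
    rw [formEval_formPair, formEval_formPair, vectorEval_translate, vectorEval_translate,
      inner_smul_left, inner_smul_right]
    linear_combination
      (inner ℂ x (vectorEval q t) * inner ℂ (vectorEval p t) y) * monomial_mul_conj n.toAdd t
  -- `H` embeds as the constant polynomials, isometrically because `φ 0 = 1`.
  let V : H →ₗᵢ[ℂ] UniformSpace.Completion ((Fin κ → ℤ) →₀ H) :=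
    ((UniformSpace.Completion.toComplₗᵢ (𝕜 := ℂ)).toLinearMap ∘ₗ
      Finsupp.lsingle (0 : Fin κ → ℤ)).isometryOfInner fun f g => by
        rw [LinearMap.comp_apply, LinearMap.comp_apply]
        refine (UniformSpace.Completion.inner_coe _ _).trans ?_
        rw [Finsupp.lsingle_apply, Finsupp.lsingle_apply, hsingle 0 h0, hφ0, one_apply_eq_self]
  have hV : ∀ f, V f = ((Finsupp.single 0 f : (Fin κ → ℤ) →₀ H) :
    UniformSpace.Completion ((Fin κ → ℤ) →₀ H)) := fun f => rfl
  refine ⟨UniformSpace.Completion ((Fin κ → ℤ) →₀ H), inferInstance, inferInstance, inferInstance,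
    V, ρ, hρ, fun α hα f g => ?_⟩
  rw [hV, hV, hρS, UniformSpace.Completion.inner_coe, translate_single, toAdd_ofAdd, add_zero,
    hsingle α hα]

/-- The components of a trigonometric polynomial with vector coefficients become analytic after
multiplication with a common monomial. -/
theorem exists_monomial_mul_inner_mem (q : (Fin κ → ℤ) →₀ H) :
    ∃ N : Fin κ → ℤ, ∀ x : H,
      (fun t => monomial N t * inner ℂ x (vectorEval q t)) ∈ analyticTrigPolys κ := by
  refine ⟨∑ n ∈ q.support, fun i => |n i|, fun x => mem_trigPolys_of_span.2 ?_⟩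
  have e : (fun t => monomial (∑ n ∈ q.support, fun i => |n i|) t * inner ℂ x (vectorEval q t))
      = ∑ l ∈ q.support, inner ℂ x (q l) •
        (monomial ((∑ n ∈ q.support, fun i => |n i|) + l) : Torus κ → ℂ) := by
    funext t
    simp only [vectorEval_apply, Finsupp.sum, inner_sum, inner_smul_right, Finset.mul_sum,
      Finset.sum_apply, Pi.smul_apply, smul_eq_mul, monomial_add]
    exact Finset.sum_congr rfl fun l _ => by ring
  rw [e]
  refine Submodule.sum_mem _ fun l hl => Submodule.smul_mem _ _ (Submodule.subset_span
    ⟨_, fun i => ?_, rfl⟩)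
  have h1 : |l i| ≤ ∑ n ∈ q.support, |n i| :=
    Finset.single_le_sum (f := fun n : Fin κ → ℤ => |n i|) (fun _ _ => abs_nonneg _) hl
  have h2 := neg_abs_le (l i)
  simp only [Pi.add_apply, Finset.sum_apply]
  linarith

/-- The matrix of a formal linear combination with respect to a finite family of vectors. -/
noncomputable def formMatrix {m : ℕ} (b : Fin m → H) (e : ((Fin κ → ℤ) × H × H) →₀ ℂ)
    (i j : Fin m) : (Fin κ → ℤ) →₀ ℂ :=
  e.sum fun p c => Finsupp.single p.1 (c * (inner ℂ (b i) p.2.1 * inner ℂ p.2.2 (b j)))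

theorem formMatrix_sum {m : ℕ} (b : Fin m → H) (e : ((Fin κ → ℤ) × H × H) →₀ ℂ) (i j : Fin m)
    (w : (Fin κ → ℤ) → ℂ) : (formMatrix b e i j).sum (fun α c => c * w α)
      = e.sum fun p c => c * (inner ℂ (b i) p.2.1 * inner ℂ p.2.2 (b j)) * w p.1 := by
  rw [formMatrix, Finsupp.sum_sum_index (by simp) (by intros; ring)]
  refine Finset.sum_congr rfl fun p _ => ?_
  exact Finsupp.sum_single_index (by simp)

theorem formMatrix_mem {m : ℕ} (b : Fin m → H) {T : Set (Fin κ → ℤ)}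
    {e : ((Fin κ → ℤ) × H × H) →₀ ℂ} (he : e ∈ formSupported H T) (i j : Fin m) :
    ∀ α ∈ (formMatrix b e i j).support, α ∈ T := by
  have : formMatrix b e i j ∈ Finsupp.supported ℂ ℂ T :=
    Submodule.sum_mem _ fun p hp => Finsupp.single_mem_supported ℂ _ (he hp)
  exact fun α hα => this hα

end Dilation

/-! ### From positivity to a dilation and commutativity -/

section Main

variable {H : Type u} [NormedAddCommGroup H] [InnerProductSpace ℂ H] [CompleteSpace H] {κ : ℕ}

open Classical in
/-- The function `α ↦ A^{[α]}`, extended by zero to `ℤ^κ`. -/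
noncomputable def extendedPow (A : Fin κ → H →L[ℂ] H) (α : Fin κ → ℤ) : H →L[ℂ] H :=
  if h : α ∈ signedIndices κ then signedPow A ⟨α, h⟩ else 0

theorem extendedPow_coe (A : Fin κ → H →L[ℂ] H) (α : signedIndices κ) :
    extendedPow A (α : Fin κ → ℤ) = signedPow A α :=
  dif_pos α.2

theorem zero_mem_signedIndices : (0 : Fin κ → ℤ) ∈ signedIndices κ :=
  Or.inl fun _ => le_rfl

theorem neg_mem_signedIndices {α : Fin κ → ℤ} (h : α ∈ signedIndices κ) :
    -α ∈ signedIndices κ := by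
  rcases h with h | h
  · exact Or.inr fun i => neg_nonpos.2 (h i)
  · exact Or.inl fun i => neg_nonneg.2 (h i)

theorem extendedPow_natCast (A : Fin κ → H →L[ℂ] H) (α : Fin κ → ℕ) :
    extendedPow A (fun i => (α i : ℤ)) = multiPow A α := by
  have h : (fun i => (α i : ℤ)) ∈ nonnegIndices κ := fun i => Int.natCast_nonneg _
  rw [extendedPow, dif_pos (show _ ∈ signedIndices κ from Or.inl h), signedPow_of_nonneg A h]
  simp

theorem extendedPow_neg_natCast (A : Fin κ → H →L[ℂ] H) (α : Fin κ → ℕ) :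
    extendedPow A (-fun i => (α i : ℤ))
      = multiPow (fun i => ContinuousLinearMap.adjoint (A i)) α := by
  have h : (-fun i => (α i : ℤ)) ∈ nonposIndices κ := fun i =>
    neg_nonpos.2 (Int.natCast_nonneg _)
  rw [extendedPow, dif_pos (show _ ∈ signedIndices κ from Or.inr h), signedPow_of_nonpos A h]
  simp

theorem extendedPow_zero (A : Fin κ → H →L[ℂ] H) : extendedPow A 0 = 1 := by
  have := extendedPow_natCast A 0
  rwa [multiPow_zero] at this

/-- Positivity on matrix trigonometric polynomials which are sums of hermitian squares on a
determining set implies positivity on symbols. -/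
theorem isSquarePositive_extendedPow {A : Fin κ → H →L[ℂ] H} {Y : Set (Torus κ)}
    (h : ∀ (m : ℕ) (a : Fin m → Fin m → signedIndices κ →₀ ℂ),
      (∃ (k : ℕ) (q : Fin m → Fin k → Torus κ → ℂ), (∀ i l, q i l ∈ analyticTrigPolys κ) ∧
        ∀ t ∈ Y, ∀ i j, trigSum (a i j) t = ∑ l, q i l t * conj (q j l t)) →
      ∀ f : Fin m → H, 0 ≤ operatorSum A a f) :
    IsSquarePositive (signedIndices κ) (extendedPow A) := by
  intro e he l hl
  -- Expanding the finitely many vectors of `e` in one finite family `b` turns the symbol into a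
  -- scalar matrix polynomial, and the operator sum at `b` becomes the functional at `e`.
  obtain ⟨m, b, hb⟩ := exists_finite_expansion fun p : e.support × Bool =>
    if p.2 then (p.1 : (Fin κ → ℤ) × H × H).2.1 else (p.1 : (Fin κ → ℤ) × H × H).2.2
  have hb1 : ∀ p ∈ e.support, ∑ k, inner ℂ (b k) p.2.1 • b k = p.2.1 := fun p hp => by
    simpa using hb (⟨p, hp⟩, true)
  have hb2 : ∀ p ∈ e.support, ∑ k, inner ℂ (b k) p.2.2 • b k = p.2.2 := fun p hp => by
    simpa using hb (⟨p, hp⟩, false)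
  let a : Fin m → Fin m → signedIndices κ →₀ ℂ := fun i j =>
    (formMatrix b e i j).subtypeDomain (· ∈ signedIndices κ)
  have ha : ∀ i j (w : (Fin κ → ℤ) → ℂ), (a i j).sum (fun α c => c * w α)
      = e.sum fun p c => c * (inner ℂ (b i) p.2.1 * inner ℂ p.2.2 (b j)) * w p.1 := fun i j w => by
    rw [← formMatrix_sum]
    exact Finsupp.sum_subtypeDomain_index (h := fun α c => c * w α) (formMatrix_mem b he i j)
  have htrig : ∀ i j t, trigSum (a i j) t = formEval e t (b i) (b j) := fun i j t => by
    rw [trigSum, ha i j fun α => monomial α t, formEval_apply]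
    exact Finset.sum_congr rfl fun p _ => by ring
  have hop : operatorSum A a b = formFunctional (extendedPow A) e := by
    simp only [operatorSum, ← extendedPow_coe]
    simp only [fun i j => ha i j fun α => inner ℂ (b j) (extendedPow A α (b i))]
    simp only [formFunctional, Finsupp.linearCombination_apply, Finsupp.sum]
    rw [Finset.sum_congr rfl fun i _ => Finset.sum_comm, Finset.sum_comm]
    refine Finset.sum_congr rfl fun p hp => ?_
    conv_rhs => rw [← hb1 p hp, ← hb2 p hp]
    simp only [map_sum, map_smul, sum_inner, inner_sum, inner_smul_left, inner_smul_right,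
      inner_conj_symm, smul_eq_mul, Finset.mul_sum]
    refine Finset.sum_congr rfl fun i _ => Finset.sum_congr rfl fun j _ => ?_
    ring
  rw [← hop]
  -- Multiplying a summand `q` by the unimodular `λ^(N q)` leaves its hermitian square unchanged and
  -- makes its components analytic.
  choose N hN using fun q : (Fin κ → ℤ) →₀ H => exists_monomial_mul_inner_mem q
  let g : ((Fin κ → ℤ) →₀ H) → Fin m → Torus κ → ℂ := fun q i t =>
    monomial (N q) t * inner ℂ (b i) (vectorEval q t)
  refine h m a ⟨l.length, fun i k => g l[k.1] i, fun i k => hN l[k.1] (b i),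
    fun t _ i j => ?_⟩ b
  rw [htrig, hl, Fin.sum_univ_fun_getElem l fun q => g q i t * conj (g q j t), squareSum]
  congr 2
  funext q
  simp only [g, map_mul, inner_conj_symm]
  linear_combination (-(inner ℂ (b i) (vectorEval q t) * inner ℂ (vectorEval q t) (b j)))
    * monomial_mul_conj (N q) t

theorem adjoint_extendedPow {A : Fin κ → H →L[ℂ] H}
    (h : IsSquarePositive (signedIndices κ) (extendedPow A)) (α : Fin κ → ℤ) :
    extendedPow A (-α) = ContinuousLinearMap.adjoint (extendedPow A α) := by
  by_cases hα : α ∈ signedIndices κ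
  · exact h.adjoint_eq zero_mem_signedIndices (extendedPow_zero A) hα (neg_mem_signedIndices hα)
  · have hα' : -α ∉ signedIndices κ := fun h' => hα (by simpa using neg_mem_signedIndices h')
    rw [extendedPow, extendedPow, dif_neg hα, dif_neg hα', map_zero]

theorem multiPow_single_add_single {M : Type*} [Monoid M] (A : Fin κ → M) {i j : Fin κ}
    (hij : i < j) : multiPow A (Pi.single i 1 + Pi.single j 1) = A i * A j := by
  induction κ with
  | zero => exact i.elim0
  | succ κ ih =>
    obtain ⟨j, rfl⟩ := Fin.exists_succ_eq.2 (Fin.ne_zero_of_lt hij)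
    rw [multiPow_succ_eq]
    have e : ∀ k : Fin κ, (fun l : Fin κ => (Pi.single k.succ 1 : Fin (κ + 1) → ℕ) l.succ)
        = Pi.single k 1 := fun k => by
      funext l; simp [Pi.single_apply]
    induction i using Fin.cases with
    | zero =>
      have : (fun l : Fin κ => (Pi.single 0 1 + Pi.single j.succ 1 : Fin (κ + 1) → ℕ) l.succ)
          = Pi.single j 1 := by
        rw [← e]; funext l; simp
      rw [this, multiPow_single]
      simp
    | succ i =>
      have : (fun l : Fin κ => (Pi.single i.succ 1 + Pi.single j.succ 1 : Fin (κ + 1) → ℕ) l.succ)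
          = Pi.single i 1 + Pi.single j 1 := by
        rw [← e, ← e]; rfl
      rw [this, ih (fun k => A k.succ) (Fin.succ_lt_succ_iff.1 hij)]
      simp

/-- For `i < j`, the adjoint relation at the index `e_i + e_j` reads `A_i* A_j* = (A_i A_j)* = A_j*
A_i*`, because the ordering convention is the same for both signs. -/
theorem commute_of_isSquarePositive {A : Fin κ → H →L[ℂ] H}
    (h : IsSquarePositive (signedIndices κ) (extendedPow A)) (i j : Fin κ) :
    Commute (A i) (A j) := by
  have key : ∀ {i j : Fin κ}, i < j → Commute (A i) (A j) := by
    intro i j hij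
    have := adjoint_extendedPow h fun k => ((Pi.single i 1 + Pi.single j 1 : Fin κ → ℕ) k : ℤ)
    rw [extendedPow_neg_natCast, extendedPow_natCast, multiPow_single_add_single _ hij,
      multiPow_single_add_single _ hij] at this
    simp only [← ContinuousLinearMap.star_eq_adjoint] at this
    rw [← star_mul, star_inj] at this
    exact this.symm
  rcases lt_trichotomy i j with hij | rfl | hij
  · exact key hij
  · exact Commute.refl _
  · exact (key hij).symm

theorem hasUnitaryPowerDilation_of_isSquarePositive {A : Fin κ → H →L[ℂ] H}
    (h : IsSquarePositive (signedIndices κ) (extendedPow A)) : HasUnitaryPowerDilation A := by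
  obtain ⟨K, _, _, _, V, ρ, hρ, hd⟩ := h.exists_representation zero_mem_signedIndices
    (fun _ => neg_mem_signedIndices) (extendedPow_zero A) (adjoint_extendedPow h)
  refine ⟨K, _, _, ‹_›, V, fun i => ρ (Multiplicative.ofAdd (Pi.single i 1)), fun i => hρ _,
    fun i j => (Commute.all _ _).map ρ, fun α f => ?_⟩
  rw [← map_multiPow ρ, multiPow_ofAdd_single]
  -- The projection is characterised by orthogonality of the difference to `V(H)`, which is the
  -- compression identity of the representation at the nonnegative index `α`.
  refine (Submodule.eq_starProjection_of_mem_of_inner_eq_zero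
    (LinearMap.mem_range_self V.toLinearMap _) ?_).symm
  rintro _ ⟨g, rfl⟩
  rw [← inner_conj_symm, inner_sub_right]
  have h1 := hd (fun i => (α i : ℤ)) (Or.inl fun i => Int.natCast_nonneg _) f g
  rw [extendedPow_natCast] at h1
  have h2 : inner ℂ (V g) (V (multiPow A α f)) = inner ℂ g (multiPow A α f) := V.inner_map_map _ _
  exact (map_eq_zero _).2 (sub_eq_zero.2 (h1.trans h2.symm))

end Main

end UnitaryPowerDilation

theorem mainTheorem5 {H : Type*} [NormedAddCommGroup H] [InnerProductSpace ℂ H] [CompleteSpace H]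
    {κ : ℕ} (hκ : 0 < κ) (A : Fin κ → H →L[ℂ] H) (Y : Set (UnitaryPowerDilation.Torus κ))
    (hY : UnitaryPowerDilation.IsDetermining (UnitaryPowerDilation.analyticTrigPolys κ) Y) :
    List.TFAE [
      UnitaryPowerDilation.HasUnitaryPowerDilation A ∧ ∀ i j, Commute (A i) (A j),
      ∀ (m : ℕ) (a : Fin m → Fin m → UnitaryPowerDilation.signedIndices κ →₀ ℂ),
        (∀ (t : UnitaryPowerDilation.Torus κ) (z : Fin m → ℂ),
          0 ≤ ∑ i, ∑ j, UnitaryPowerDilation.trigSum (a i j) t * z i * conj (z j)) →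
        ∀ f : Fin m → H, 0 ≤ UnitaryPowerDilation.operatorSum A a f,
      ∀ (m : ℕ) (a : Fin m → Fin m → UnitaryPowerDilation.signedIndices κ →₀ ℂ),
        (∃ (k : ℕ) (q : Fin m → Fin k → UnitaryPowerDilation.Torus κ → ℂ),
          (∀ i l, q i l ∈ UnitaryPowerDilation.analyticTrigPolys κ) ∧
          ∀ t ∈ Y, ∀ i j,
            UnitaryPowerDilation.trigSum (a i j) t = ∑ l, q i l t * conj (q j l t)) →
        ∀ f : Fin m → H, 0 ≤ UnitaryPowerDilation.operatorSum A a f] := by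
  tfae_have 1 → 2 := fun h _ a ha f => h.1.operatorSum_nonneg h.2 a ha f
  tfae_have 2 → 3 := by
    rintro h m a ⟨k, q, hq, hqa⟩ f
    refine h m a (fun t z => ?_) f
    -- The factorization, extended from `Y` to the torus, makes the quadratic form a sum of squared
    -- moduli.
    have e : ∑ i, ∑ j, UnitaryPowerDilation.trigSum (a i j) t * z i * conj (z j)
        = ∑ l, (∑ i, q i l t * z i) * conj (∑ i, q i l t * z i) := by
      simp only [fun i j => hY.trigSum_eq (a i j) (hq i) (hq j) (fun t ht => hqa t ht i j) t,
        map_sum, map_mul, Finset.sum_mul, Finset.mul_sum]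
      rw [Finset.sum_congr rfl fun i _ => Finset.sum_comm, Finset.sum_comm]
      refine Finset.sum_congr rfl fun l _ => ?_
      rw [Finset.sum_comm]
      refine Finset.sum_congr rfl fun j _ => Finset.sum_congr rfl fun i _ => ?_
      ring
    rw [e]
    refine Finset.sum_nonneg fun l _ => ?_
    rw [Complex.mul_conj, Complex.zero_le_real]
    exact Complex.normSq_nonneg _
  tfae_have 3 → 1 := fun h =>
    have hp := UnitaryPowerDilation.isSquarePositive_extendedPow h
    ⟨UnitaryPowerDilation.hasUnitaryPowerDilation_of_isSquarePositive hp,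
      UnitaryPowerDilation.commute_of_isSquarePositive hp⟩
  tfae_finish
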